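/- Let $\mathbb{S}$ be the Sierpinski space, with points $0,1$ and open sets $\emptyset,\{1\},\{0,1\}$, and let $2=\{0<1\}$ be the two-element frame. Let $\mathbf{Frm}$ be the category of frames and maps preserving finite meets and arbitrary joins. Let $\mathcal{L}$ be the free frame monad on $\mathbf{Set}$; it sends $X$ to the set $\mathcal{L}X$ of upwards closed families of finite subsets of $X$, and $x\in X$ is identified with the generator $\{F : x\in F\}\in\mathcal{L}X$. Let $I_{\mathcal{L}}\colon\mathbf{Kl}(\mathcal{L})\to\mathbf{Frm}$ be the canonical embedding of its Kleisli category, sending a set to its free frame. Let $J\colon\mathbf{Sier}\hookrightarrow\mathbf{Top}$ be the full subcategory on the powers $\mathbb{S}^X$, $X$ any set. Let $\mathcal{S}$ be the sobrification monad on $\mathbf{Top}$, $\mathcal{S}X=\mathbf{Frm}(\mathbf{Top}(X,\mathbb{S}),2)$, that is, the monad induced by the dual adjunction $\mathbf{Top}(-,\mathbb{S})\dashv\mathbf{Frm}(-,2)\colon\mathbf{Frm}^{\mathrm{op}}\to\mathbf{Top}$ whose unit and counit are given by evaluation. Here $\mathbf{Top}(X,\mathbb{S})$ is ordered pointwise,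 and $\mathbf{Frm}(A,2)$ is a subspace of the product space $\mathbb{S}^{A}$. 1. The functor $E\colon\mathbf{Kl}(\mathcal{L})^{\mathrm{op}}\to\mathbf{Sier}$ that sends a set $X$ to $\mathbb{S}^X$ and a Kleisli morphism $f\colon X\to\mathcal{L}Y$ to the continuous map $\mathbb{S}^Y\to\mathbb{S}^X$, $p\mapsto\hat p\circ f$, where $\hat p\colon\mathcal{L}Y\to 2$ is the unique frame homomorphism extending $p\colon Y\to 2$, is an equivalence of categories. 2. Restriction of frame homomorphisms to generators defines homeomorphisms $\mathbf{Frm}(\mathcal{L}X,2)\cong\mathbb{S}^X$ that form a natural isomorphism $J\circ E\cong\mathbf{Frm}(-,2)\circ I_{\mathcal{L}}^{\mathrm{op}}$. 3. The codensity monad of $J$ exists, its underlying right Kan extension of $J$ along $J$ is pointwise (that is, for every space $X$ the canonical limit $\lim_{X\to JA}JA$ exists), and it is isomorphic, as a monad on $\mathbf{Top}$, to the sobrification monad $\mathcal{S}$. -/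

import Mathlib

open CategoryTheory OrderDual

universe u v w v₁ u₁ v₂ u₂

/-! ### Codensity monads -/

section Codensity

variable {A : Type u₁} [Category.{v₁} A] {C : Type u₂} [Category.{v₂} C]
variable (F : A ⥤ C) [F.HasRightKanExtension F]

/-- The unit of the codensity monad: the transformation `𝟭 ⟶ Ran_F F` that corresponds to the
identity `F ⟶ F`. -/
noncomputable def codensityUnit : 𝟭 C ⟶ F.rightKanExtension F :=
  (F.rightKanExtension F).liftOfIsRightKanExtension (F.rightKanExtensionCounit F) (𝟭 C)
    F.rightUnitor.hom

/-- The multiplication of the codensity monad: the transformation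
`Ran_F F ∘ Ran_F F ⟶ Ran_F F` that corresponds to `φ ∘ (Ran_F F) φ`, where `φ` is the counit of the
right Kan extension. -/
noncomputable def codensityMult :
    F.rightKanExtension F ⋙ F.rightKanExtension F ⟶ F.rightKanExtension F :=
  (F.rightKanExtension F).liftOfIsRightKanExtension (F.rightKanExtensionCounit F) _
    ((Functor.associator _ _ _).inv ≫
      Functor.whiskerRight (F.rightKanExtensionCounit F) (F.rightKanExtension F) ≫
      F.rightKanExtensionCounit F)

theorem codensityUnit_counit (a : A) :
    (codensityUnit F).app (F.obj a) ≫ (F.rightKanExtensionCounit F).app a = 𝟙 (F.obj a) := by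
  simp [codensityUnit]

theorem codensityMult_counit (a : A) :
    (codensityMult F).app (F.obj a) ≫ (F.rightKanExtensionCounit F).app a =
      (F.rightKanExtension F).map ((F.rightKanExtensionCounit F).app a) ≫
        (F.rightKanExtensionCounit F).app a := by
  simp [codensityMult]

/-- The codensity monad of a functor `F`, carried by the right Kan extension of `F` along
itself. -/
noncomputable def codensityMonad : Monad C where
  toFunctor := F.rightKanExtension F
  η := codensityUnit F
  μ := codensityMult F
  assoc X := by
    let T := F.rightKanExtension F
    let l : (T ⋙ T) ⋙ T ⟶ T := Functor.whiskerRight (codensityMult F) T ≫ codensityMult F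
    let r : (T ⋙ T) ⋙ T ⟶ T := Functor.whiskerLeft T (codensityMult F) ≫ codensityMult F
    have h : l = r := by
      apply T.hom_ext_of_isRightKanExtension (F.rightKanExtensionCounit F)
      ext a
      simp only [l, r, T, Functor.whiskerLeft_app, NatTrans.comp_app, Functor.whiskerRight_app,
        Category.assoc, codensityMult_counit, Functor.comp_obj]
      rw [← NatTrans.naturality_assoc, codensityMult_counit, ← Functor.map_comp_assoc,
        codensityMult_counit, Functor.comp_map, ← Functor.map_comp_assoc]
    exact congr_app h X
  left_unit X := by
    let T := F.rightKanExtension F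
    let l : T ⟶ T := Functor.whiskerLeft T (codensityUnit F) ≫ codensityMult F
    have h : l = 𝟙 T := by
      apply T.hom_ext_of_isRightKanExtension (F.rightKanExtensionCounit F)
      ext a
      simp only [l, T, Functor.whiskerLeft_app, NatTrans.comp_app,
        Category.assoc, codensityMult_counit, NatTrans.id_app]
      rw [← NatTrans.naturality_assoc, codensityUnit_counit]
      simp
    exact congr_app h X
  right_unit X := by
    let T := F.rightKanExtension F
    let l : T ⟶ T := Functor.whiskerRight (codensityUnit F) T ≫ codensityMult F
    have h : l = 𝟙 T := by
      apply T.hom_ext_of_isRightKanExtension (F.rightKanExtensionCounit F)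
      ext a
      simp only [l, T, Functor.whiskerLeft_app, NatTrans.comp_app, Functor.whiskerRight_app,
        Category.assoc, codensityMult_counit, NatTrans.id_app]
      rw [← Functor.map_comp_assoc, codensityUnit_counit]
      simp
    exact congr_app h X

end Codensity

/-! ### The free frame monad -/

/-- The free frame on `X`: upwards closed subsets of the poset of finite subsets of `X`, ordered by
inclusion. -/
abbrev FreeFrame (X : Type u) : Type u := LowerSet (Finset X)ᵒᵈ

namespace FreeFrame

/-- The insertion of generators: `x` is sent to the set of all finite subsets that contain `x`. -/
def gen {X : Type u} (x : X) : FreeFrame X where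
  carrier := {F | x ∈ ofDual F}
  lower' _ _ h hF := h hF

/-- The frame homomorphism `U ↦ ⋁_{F ∈ U} ⋀_{x ∈ F} f x` that extends a map `f` from `X` to a
frame. -/
def lift {X : Type u} {A : Type v} [Order.Frame A] (f : X → A) : FrameHom (FreeFrame X) A where
  toFun U := ⨆ (F : Finset X) (_ : toDual F ∈ U), F.inf f
  map_inf' U V := by
    classical
    apply le_antisymm
    · refine iSup₂_le fun F hF => le_inf ?_ ?_
      · exact le_iSup₂_of_le F hF.1 le_rfl
      · exact le_iSup₂_of_le F hF.2 le_rfl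
    · rw [iSup₂_inf_eq]
      refine iSup₂_le fun F hF => ?_
      rw [inf_iSup₂_eq]
      refine iSup₂_le fun G hG => ?_
      refine le_iSup₂_of_le (F ∪ G) ⟨?_, ?_⟩ ?_
      · exact U.lower (toDual_le_toDual.2 Finset.subset_union_left) hF
      · exact V.lower (toDual_le_toDual.2 Finset.subset_union_right) hG
      · rw [Finset.inf_union]
  map_top' := top_le_iff.1 (le_iSup₂_of_le ∅ trivial (by simp))
  map_sSup' S := by
    apply le_antisymm
    · refine iSup₂_le fun F hF => ?_
      obtain ⟨U, hU, hFU⟩ := LowerSet.mem_sSup_iff.1 hF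
      exact le_sSup_of_le ⟨U, hU, rfl⟩ (le_iSup₂_of_le F hFU le_rfl)
    · refine sSup_le ?_
      rintro _ ⟨U, hU, rfl⟩
      exact iSup₂_le fun F hF =>
        le_iSup₂_of_le F (LowerSet.mem_sSup_iff.2 ⟨U, hU, hF⟩) le_rfl

theorem lift_gen {X : Type u} {A : Type v} [Order.Frame A] (f : X → A) (x : X) :
    lift f (gen x) = f x := by
  apply le_antisymm
  · exact iSup₂_le fun F hF => Finset.inf_le hF
  · exact le_iSup₂_of_le {x} (Finset.mem_singleton_self x) (by simp)

theorem eq_iSup {X : Type u} (U : FreeFrame X) :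
    U = ⨆ (F : Finset X) (_ : toDual F ∈ U), F.inf gen := by
  have key : ∀ F G : Finset X, toDual G ∈ F.inf (gen (X := X)) ↔ F ⊆ G := by
    classical
    intro F G
    induction F using Finset.induction_on with
    | empty => simp
    | insert a s _ ih =>
      rw [Finset.inf_insert, LowerSet.mem_inf_iff, ih, Finset.insert_subset_iff]
      rfl
  ext G
  change toDual (ofDual G) ∈ U ↔ _
  simp only [SetLike.mem_coe, LowerSet.mem_iSup_iff]
  constructor
  · intro h
    exact ⟨ofDual G, h, (key _ _).2 subset_rfl⟩
  · rintro ⟨F, hF, hG⟩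
    exact U.lower (toDual_le_toDual.2 ((key F (ofDual G)).1 hG)) hF

theorem hom_ext {X : Type u} {A : Type v} [Order.Frame A] {g h : FrameHom (FreeFrame X) A}
    (H : ∀ x, g (gen x) = h (gen x)) : g = h := by
  ext U
  rw [eq_iSup U]
  simp only [map_iSup, map_finset_inf]
  have : (g ∘ gen : X → A) = h ∘ gen := funext H
  rw [this]

theorem hom_lift {X : Type u} {A : Type v} {B : Type w} [Order.Frame A] [Order.Frame B]
    (g : FrameHom A B) (f : X → A) : g.comp (lift f) = lift fun x => g (f x) :=
  hom_ext fun x => by simp [lift_gen]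

/-- The universal property of the free frame. -/
def homEquiv (X : Type u) (A : Frm.{u}) :
    (Frm.of (FreeFrame X) ⟶ A) ≃ (X ⟶ (forget Frm.{u}).obj A) where
  toFun g := TypeCat.ofHom fun x => g.hom (gen x)
  invFun f := Frm.ofHom (lift fun x => (f x : A))
  left_inv g := by
    apply Frm.hom_ext
    exact hom_ext fun x => lift_gen _ x
  right_inv f := by
    ext x
    exact lift_gen _ x

end FreeFrame

/-- The free frame functor. -/
def freeFrame : Type u ⥤ Frm.{u} :=
  Adjunction.leftAdjointOfEquiv (G := forget Frm.{u}) FreeFrame.homEquiv fun _ _ _ _ _ => rfl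

/-- The free frame functor is left adjoint to the forgetful functor. -/
def freeFrameAdjunction : freeFrame.{u} ⊣ forget Frm.{u} :=
  Adjunction.adjunctionOfEquivLeft FreeFrame.homEquiv fun _ _ _ _ _ => rfl

/-- The free frame monad on the category of sets. -/
def freeFrameMonad : Monad (Type u) := freeFrameAdjunction.toMonad

/-- The map from `X` to the free frame on `Y` that underlies a Kleisli morphism. -/
def kleisliFun {X Y : Kleisli freeFrameMonad.{u}} (f : X ⟶ Y) (x : X.of) : FreeFrame Y.of :=
  f.of x

/-- The extension of a map `f : X → L Y` to a frame homomorphism `L X → L Y`. -/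
def kleisliExtend {X Y : Kleisli freeFrameMonad.{u}} (f : X ⟶ Y) :
    FrameHom (FreeFrame X.of) (FreeFrame Y.of) :=
  FreeFrame.lift (kleisliFun f)

theorem kleisliExtend_id (X : Kleisli freeFrameMonad.{u}) :
    kleisliExtend (𝟙 X) = FrameHom.id _ :=
  FreeFrame.hom_ext fun x => FreeFrame.lift_gen _ x

theorem kleisli_comp_apply {X Y Z : Kleisli freeFrameMonad.{u}} (f : X ⟶ Y) (g : Y ⟶ Z)
    (x : X.of) : kleisliFun (f ≫ g) x = kleisliExtend g (kleisliFun f x) := by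
  have h : FrameHom.comp
      (FreeFrame.lift (fun W : FreeFrame Z.of => W) : FrameHom (FreeFrame (FreeFrame Z.of)) _)
      (FreeFrame.lift fun y => FreeFrame.gen (kleisliFun g y)) = kleisliExtend g := by
    rw [FreeFrame.hom_lift]
    exact congrArg FreeFrame.lift (funext fun y => FreeFrame.lift_gen _ _)
  rw [← h]
  rfl

theorem kleisliExtend_comp {X Y Z : Kleisli freeFrameMonad.{u}} (f : X ⟶ Y) (g : Y ⟶ Z) :
    kleisliExtend (f ≫ g) = (kleisliExtend g).comp (kleisliExtend f) := by
  refine Eq.trans ?_ (FreeFrame.hom_lift _ _).symm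
  exact congrArg FreeFrame.lift (funext fun x => kleisli_comp_apply f g x)

/-- The embedding of the Kleisli category of the free frame monad into the category of frames as
the full subcategory of free frames. -/
def kleisliToFrm : Kleisli freeFrameMonad.{u} ⥤ Frm.{u} where
  obj X := Frm.of (FreeFrame X.of)
  map f := Frm.ofHom (kleisliExtend f)
  map_id X := by rw [kleisliExtend_id]; rfl
  map_comp f g := by rw [kleisliExtend_comp]; rfl

/-! ### The sobrification monad

The type `Prop` carries the Sierpinski topology, whose open sets are `∅`, `{True}` and the whole
space, and it is the two-element frame `2`. -/

section SierpinskiFrame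

variable (X : Type u) [TopologicalSpace X]

/-- The continuous maps from `X` to the Sierpinski space form a complete lattice under the pointwise
order. Finite meets and arbitrary joins are computed pointwise. -/
noncomputable instance sierpinskiCompleteLattice : CompleteLattice C(X, Prop) where
  __ := (inferInstance : SemilatticeSup C(X, Prop))
  __ := completeLatticeOfSup (α := C(X, Prop))
    (H2 := ⟨fun S => ⟨fun x => ∃ f ∈ S, f x, continuous_Prop.2 (by
      have : {x | ∃ f ∈ S, f x} = ⋃ f ∈ S, {x | f x} := by ext; simp
      rw [this]
      exact isOpen_biUnion fun f _ => continuous_Prop.1 f.continuous)⟩⟩)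
    (fun S => ⟨fun f hf x hx => ⟨f, hf, hx⟩, fun g hg x hx => by
      obtain ⟨f, hf, hfx⟩ := hx
      exact hg hf x hfx⟩)
  inf f g := ⟨fun x => f x ∧ g x, continuous_Prop.2
    ((continuous_Prop.1 f.continuous).inter (continuous_Prop.1 g.continuous))⟩
  inf_le_left _ _ _ h := h.1
  inf_le_right _ _ _ h := h.2
  le_inf _ _ _ h₁ h₂ x h := ⟨h₁ x h, h₂ x h⟩
  top := ⟨fun _ => True, continuous_const⟩
  le_top _ _ _ := trivial

variable {X}

theorem sierpinski_inf_apply (f g : C(X, Prop)) (x : X) : (f ⊓ g) x ↔ f x ∧ g x := Iff.rfl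

theorem sierpinski_sSup_apply (S : Set C(X, Prop)) (x : X) : (sSup S) x ↔ ∃ f ∈ S, f x := Iff.rfl

variable (X)

/-- The frame of continuous maps from `X` to the Sierpinski space. -/
noncomputable instance sierpinskiFrame : Order.Frame C(X, Prop) :=
  Order.Frame.ofMinimalAxioms
    { inf_sSup_le_iSup_inf := fun f S x hx => by
        obtain ⟨hf, g, hg, hgx⟩ := hx
        exact (le_iSup₂_of_le (f := fun b (_ : b ∈ S) => f ⊓ b) g hg le_rfl) x ⟨hf, hgx⟩ }

end SierpinskiFrame

/-- Precomposition with a continuous map, as a frame homomorphism. -/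
def sierpinskiPrecomp {X Y : Type u} [TopologicalSpace X] [TopologicalSpace Y] (f : C(X, Y)) :
    FrameHom C(Y, Prop) C(X, Prop) where
  toFun g := g.comp f
  map_inf' _ _ := rfl
  map_top' := rfl
  map_sSup' S := by
    ext x
    rw [sierpinski_sSup_apply]
    simp only [Set.exists_mem_image]
    rfl

/-- The functor `Top(-, 𝕊)` from topological spaces to the opposite category of frames. -/
noncomputable def sierpinskiHom : TopCat.{u} ⥤ Frm.{u}ᵒᵖ where
  obj X := Opposite.op (Frm.of C(X, Prop))
  map f := (Frm.ofHom (sierpinskiPrecomp f.hom)).op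

theorem framePoints_continuous_eval (A : Type u) [Order.Frame A] (a : A) :
    Continuous fun p : FrameHom A Prop => p a :=
  continuous_Prop.2 ⟨a, rfl⟩

/-- The topology of the space of points `Frm(A, 2)` is that of a subspace of the product space
`𝕊 ^ A`. -/
theorem framePoints_topology (A : Type u) [Order.Frame A] :
    (inferInstance : TopologicalSpace (FrameHom A Prop)) =
      TopologicalSpace.induced (fun p (a : A) => p a) Pi.topologicalSpace := by
  apply le_antisymm
  · exact (continuous_pi fun a => framePoints_continuous_eval A a).le_induced
  · rintro _ ⟨a, rfl⟩
    exact ⟨{q | q a}, continuous_Prop.1 (continuous_apply a), rfl⟩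

theorem framePoints_continuous_iff {X : Type v} [TopologicalSpace X] {A : Type u} [Order.Frame A]
    {f : X → FrameHom A Prop} : Continuous f ↔ ∀ a, Continuous fun x => f x a := by
  have h : Topology.IsInducing fun (p : FrameHom A Prop) (a : A) => p a :=
    ⟨framePoints_topology A⟩
  rw [h.continuous_iff]
  exact continuous_pi_iff

/-- The functor `Frm(-, 2)` from the opposite category of frames to topological spaces. -/
abbrev framePoints : Frm.{u}ᵒᵖ ⥤ TopCat.{u} := Locale.pt.{u}

/-- Evaluation of continuous maps to the Sierpinski space at a point. -/
def sierpinskiEval {X : Type u} [TopologicalSpace X] (x : X) : FrameHom C(X, Prop) Prop where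
  toFun f := f x
  map_inf' _ _ := rfl
  map_top' := rfl
  map_sSup' S := by
    apply propext
    rw [sierpinski_sSup_apply, sSup_Prop_eq]
    constructor
    · rintro ⟨f, hf, hx⟩
      exact ⟨_, ⟨f, hf, rfl⟩, hx⟩
    · rintro ⟨_, ⟨f, hf, rfl⟩, hx⟩
      exact ⟨f, hf, hx⟩

/-- Evaluation of frame homomorphisms to `2` at an element. -/
def framePointsEval (A : Type u) [Order.Frame A] : FrameHom A C(FrameHom A Prop, Prop) where
  toFun a := ⟨fun p => p a, framePoints_continuous_eval A a⟩
  map_inf' a b := ContinuousMap.ext fun p => map_inf p a b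
  map_top' := ContinuousMap.ext fun p => map_top p
  map_sSup' S := by
    ext p
    rw [sierpinski_sSup_apply]
    simp only [ContinuousMap.coe_mk, map_sSup, sSup_Prop_eq, Set.exists_mem_image]

/-- The dual adjunction between `Top(-, 𝕊)` and `Frm(-, 2)`; the unit and the counit are given by
evaluation. -/
noncomputable def sobrificationAdjunction : sierpinskiHom.{u} ⊣ framePoints.{u} where
  unit :=
    { app X := TopCat.ofHom ⟨sierpinskiEval,
        framePoints_continuous_iff.2 fun f : C(X, Prop) => f.continuous⟩ }
  counit := { app A := Quiver.Hom.op (Frm.ofHom (framePointsEval A.unop)) }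

/-- The sobrification monad on the category of topological spaces. -/
noncomputable def sobrificationMonad : Monad TopCat.{u} := sobrificationAdjunction.toMonad

/-! ### Powers of the Sierpinski space -/

/-- The topological spaces `𝕊 ^ X`, for all sets `X`, with the product topology. -/
def sierpinskiPowers : ObjectProperty TopCat.{u} :=
  ObjectProperty.ofObj fun X : Type u => TopCat.of (X → Prop)

/-- The full subcategory of the category of topological spaces on the powers of the Sierpinski
space. -/
abbrev Sier : Type (u + 1) := sierpinskiPowers.{u}.FullSubcategory

/-- The inclusion functor of `Sier` into topological spaces. -/
abbrev sierInclusion : Sier.{u} ⥤ TopCat.{u} := sierpinskiPowers.{u}.ι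

theorem continuous_lift_apply {X : Type u} (U : FreeFrame X) :
    Continuous fun p : X → Prop => FreeFrame.lift p U := by
  have h : ∀ F : Finset X, IsOpen {p : X → Prop | F.inf p} := by
    classical
    intro F
    induction F using Finset.induction_on with
    | empty => simp
    | insert a s _ ih =>
      simp only [Finset.inf_insert]
      exact (continuous_Prop.1 (continuous_apply a)).inter ih
  have : {p : X → Prop | FreeFrame.lift p U} =
      ⋃ (F : Finset X) (_ : toDual F ∈ U), {p : X → Prop | F.inf p} := by
    ext p
    change (⨆ (F : Finset X) (_ : toDual F ∈ U), F.inf p) ↔ _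
    simp
  rw [continuous_Prop, this]
  exact isOpen_iUnion fun F => isOpen_iUnion fun _ => h F

/-- The functor `X ↦ 𝕊 ^ X` from the opposite of the Kleisli category of the free frame monad to
`Sier`. A Kleisli morphism `f : X → L Y` is sent to the continuous map `𝕊 ^ Y → 𝕊 ^ X` that takes
`p : Y → 2` to the composite of `f` with the frame homomorphism `L Y → 2` extending `p`; in other
words, `x` is sent to true if and only if some finite set in `f x` is contained in `p`. -/
def sierpinskiPower : (Kleisli freeFrameMonad.{u})ᵒᵖ ⥤ Sier.{u} where
  obj X := ⟨TopCat.of (X.unop.of → Prop), ⟨X.unop.of⟩⟩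
  map {Y X} f := ObjectProperty.homMk (TopCat.ofHom
    ⟨fun (p : Y.unop.of → Prop) (x : X.unop.of) =>
      FreeFrame.lift p (kleisliFun f.unop x),
      continuous_pi fun _ => continuous_lift_apply _⟩)
  map_id X := by
    ext p x
    exact iff_of_eq (FreeFrame.lift_gen p x)
  map_comp {Z Y X} f g := by
    ext p x
    change FreeFrame.lift p (kleisliFun (g.unop ≫ f.unop) x) ↔
      FreeFrame.lift (fun y => FreeFrame.lift p (kleisliFun f.unop y)) (kleisliFun g.unop x)
    rw [kleisli_comp_apply, ← FreeFrame.hom_lift]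
    rfl

/-!
A map `p` from a frame `A` to a frame `B` is a homomorphism as soon as it commutes with the
interpretations `L A → A` and `L B → B` of formal joins of finite meets. For `B = 2` this says that
`Frm(A, 2)` is the equalizer of the two continuous maps `𝕊 ^ A ⇉ 𝕊 ^ L A` that send `p` to `p̂` and
to the composite of `p` with `L A → A`. For `A = Top(X, 𝕊)` the evaluation map `X → 𝕊 ^ A` is weakly
initial among the maps from `X` to powers of `𝕊`, and it equalizes these two maps, so that the limit
over all maps from `X` to powers of `𝕊` collapses to the equalizer, which is the sobrification of
`X`.

The algebra structures of the powers of `𝕊` for the sobrification monad come from the homeomorphism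
`Frm(L X, 2) ≅ 𝕊 ^ X`, because spaces of points are sober. Every open subset of `Frm(A, 2)` is of
the form `{p | p a}`, whence sobriety; for `A = L X` it also shows that every continuous map
`𝕊 ^ X → 𝕊` is of the form `p ↦ p̂ U`, which is the fullness of `E`.
-/

open Limits

/-! ### Limits and codensity monads -/

/-- If `u` is weakly initial in the index category and the leg of a cone at `u` is an equalizer of
the images of a parallel pair `f, g : u ⟶ v`, then the cone is a limit. -/
def isLimitOfEqualizerAtWeaklyInitial {J : Type u₁} [Category.{v₁} J] {C : Type u₂}
    [Category.{v₂} C] {G : J ⥤ C} (c : Cone G) {u v : J} (hu : ∀ j, Nonempty (u ⟶ j))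
    (f g : u ⟶ v) {ι : c.pt ⟶ G.obj u} (hι : c.π.app u = ι)
    {w : ι ≫ G.map f = ι ≫ G.map g} (h : IsLimit (Fork.ofι ι w)) : IsLimit c where
  lift s := Fork.IsLimit.lift h (s.π.app u) (by rw [s.w, s.w])
  fac s j := by
    obtain ⟨k⟩ := hu j
    rw [← c.w k, ← s.w k, hι, ← Category.assoc]
    exact congrArg (· ≫ G.map k) (Fork.IsLimit.lift_ι' h _ _)
  uniq s m hm := by
    refine Fork.IsLimit.hom_ext h ((Eq.trans ?_ (hm u)).trans (Fork.IsLimit.lift_ι' h _ _).symm)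
    rw [hι]
    rfl

section Codensity

variable {A : Type u₁} [Category.{v₁} A] {C : Type u₂} [Category.{v₂} C]
variable {F : A ⥤ C} {T : Monad C}

/-- The canonical isomorphism from a right Kan extension of `F` along `F` to the chosen one, which
underlies the codensity monad. -/
noncomputable def codensityComparison {R : C ⥤ C} (α : F ⋙ R ⟶ F) [F.HasRightKanExtension F]
    [R.IsRightKanExtension α] : R ≅ F.rightKanExtension F :=
  R.rightKanExtensionUnique α (F.rightKanExtension F) (F.rightKanExtensionCounit F)

theorem codensityComparison_counit {R : C ⥤ C} (α : F ⋙ R ⟶ F) [F.HasRightKanExtension F]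
    [R.IsRightKanExtension α] (a : A) :
    (codensityComparison α).hom.app (F.obj a) ≫ (F.rightKanExtensionCounit F).app a = α.app a := by
  simp [codensityComparison]

/-- A natural family of algebra structures `T (F a) ⟶ F a` on the values of a functor `F`, in other
words, an action of the monad `T` on `F`. -/
structure IsMonadAction (T : Monad C) (α : F ⋙ T.toFunctor ⟶ F) : Prop where
  unit (a : A) : T.η.app (F.obj a) ≫ α.app a = 𝟙 (F.obj a)
  mul (a : A) : T.μ.app (F.obj a) ≫ α.app a = T.map (α.app a) ≫ α.app a

namespace IsMonadAction

variable {α : F ⋙ T.toFunctor ⟶ F} [F.HasRightKanExtension F] [T.toFunctor.IsRightKanExtension α]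

theorem unit_codensityComparison (h : IsMonadAction T α) :
    T.η ≫ (codensityComparison α).hom = codensityUnit F := by
  apply (F.rightKanExtension F).hom_ext_of_isRightKanExtension (F.rightKanExtensionCounit F)
  ext a
  simp only [Functor.whiskerLeft_app, NatTrans.comp_app, Category.assoc, codensityUnit_counit]
  rw [codensityComparison_counit]
  exact h.unit a

theorem mul_codensityComparison (h : IsMonadAction T α) :
    T.μ ≫ (codensityComparison α).hom =
      (Functor.whiskerRight (codensityComparison α).hom T.toFunctor ≫
        Functor.whiskerLeft (F.rightKanExtension F) (codensityComparison α).hom) ≫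
          codensityMult F := by
  apply (F.rightKanExtension F).hom_ext_of_isRightKanExtension (F.rightKanExtensionCounit F)
  ext a
  simp only [Functor.whiskerLeft_app, Functor.whiskerRight_app, NatTrans.comp_app, Category.assoc,
    codensityMult_counit, codensityComparison_counit]
  rw [← NatTrans.naturality_assoc, codensityComparison_counit, ← Functor.map_comp_assoc,
    codensityComparison_counit]
  exact h.mul a

/-- A monad `T` that acts on `F` such that the action exhibits `T` as a right Kan extension of `F`
along `F` is the codensity monad of `F`. -/
noncomputable def isoCodensityMonad (h : IsMonadAction T α) : T ≅ codensityMonad F :=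
  MonadIso.mk (codensityComparison α) (congr_app h.unit_codensityComparison)
    (congr_app h.mul_codensityComparison)

end IsMonadAction

variable (F T)

/-- The action of a monad on a functor at whose values the unit of the monad is invertible. -/
noncomputable def unitInvAction [∀ a, IsIso (T.η.app (F.obj a))] : F ⋙ T.toFunctor ⟶ F where
  app a := inv (T.η.app (F.obj a))
  naturality a b f := by
    rw [IsIso.comp_inv_eq, Category.assoc, IsIso.eq_inv_comp]
    exact (T.η.naturality (F.map f)).symm

theorem isMonadAction_unitInvAction [∀ a, IsIso (T.η.app (F.obj a))] :
    IsMonadAction T (unitInvAction F T) where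
  unit a := IsIso.hom_inv_id _
  mul a := by
    have h : T.μ.app (F.obj a) = T.map (inv (T.η.app (F.obj a))) := by
      rw [Functor.map_inv]
      exact IsIso.eq_inv_of_hom_inv_id (T.right_unit _)
    exact congrArg (· ≫ inv (T.η.app (F.obj a))) h

end Codensity

/-! ### Frame homomorphisms and free frames -/

namespace FreeFrame

/-- A map between frames that commutes with the interpretation of elements of free frames, as a
frame homomorphism. -/
def homOfMapLift {A : Type u} {B : Type v} [Order.Frame A] [Order.Frame B] (f : A → B)
    (h : ∀ U : FreeFrame A, f (lift id U) = lift f U) : FrameHom A B where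
  toFun := f
  map_inf' a b := by simpa [lift_gen] using h (gen a ⊓ gen b)
  map_top' := by simpa using h ⊤
  map_sSup' S := by simpa [map_sSup, Set.image_image, lift_gen] using h (sSup (gen '' S))

theorem lift_iff {X : Type u} (p : X → Prop) (U : FreeFrame X) :
    lift p U ↔ ∃ F : Finset X, toDual F ∈ U ∧ ∀ x ∈ F, p x := by
  change (⨆ (F : Finset X) (_ : toDual F ∈ U), F.inf p) ↔ _
  simp [Finset.inf_eq_iInf]

theorem lift_mem_iff {X : Type u} (F : Finset X) (U : FreeFrame X) :
    lift (fun x => x ∈ F) U ↔ toDual F ∈ U := by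
  rw [lift_iff]
  exact ⟨fun ⟨G, hG, h⟩ => U.lower (toDual_le_toDual.2 h) hG, fun h => ⟨F, h, fun _ => id⟩⟩

theorem eq_of_forall_lift_eq {X : Type u} {U V : FreeFrame X}
    (h : ∀ p : X → Prop, lift p U = lift p V) : U = V := by
  ext F
  exact (lift_mem_iff (ofDual F) U).symm.trans
    ((iff_of_eq (h _)).trans (lift_mem_iff (ofDual F) V))

/-- Restriction to generators is a homeomorphism from the space of points of the free frame on `X`
to `𝕊 ^ X`; this is its inverse. -/
def pointsHomeomorph (X : Type u) : (X → Prop) ≃ₜ FrameHom (FreeFrame X) Prop where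
  toFun := lift
  invFun h x := h (gen x)
  left_inv p := funext fun x => lift_gen p x
  right_inv _ := hom_ext fun x => lift_gen _ x
  continuous_toFun := framePoints_continuous_iff.2 continuous_lift_apply
  continuous_invFun := continuous_pi fun _ => framePoints_continuous_eval _ _

end FreeFrame

/-! ### Spaces of points -/

theorem framePointsEval_surjective (A : Type u) [Order.Frame A] :
    Function.Surjective (framePointsEval A) := fun f => by
  obtain ⟨a, ha⟩ := continuous_Prop.1 f.continuous
  exact ⟨a, ContinuousMap.ext fun p => congrArg (p ∈ ·) ha⟩

theorem exists_forall_lift_eq {X : Type u} (f : C(X → Prop, Prop)) :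
    ∃ U : FreeFrame X, ∀ p, FreeFrame.lift p U = f p := by
  let e := FreeFrame.pointsHomeomorph X
  obtain ⟨U, hU⟩ := framePointsEval_surjective _ (f.comp ⟨e.symm, e.symm.continuous⟩)
  refine ⟨U, fun p => (DFunLike.congr_fun hU (e p)).trans ?_⟩
  exact congrArg f (e.symm_apply_apply p)

/-- Spaces of points are sober: every point of the frame of continuous maps from `Frm(A, 2)` to `𝕊`
is the evaluation at a unique point of `Frm(A, 2)`. -/
noncomputable def sierpinskiEvalHomeomorph (A : Type u) [Order.Frame A] :
    FrameHom A Prop ≃ₜ FrameHom C(FrameHom A Prop, Prop) Prop where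
  toFun := sierpinskiEval
  invFun φ := φ.comp (framePointsEval A)
  left_inv _ := rfl
  right_inv _ := FrameHom.ext <| (framePointsEval_surjective A).forall.2 fun _ => rfl
  continuous_toFun := framePoints_continuous_iff.2 fun f => f.continuous
  continuous_invFun := framePoints_continuous_iff.2 fun _ => framePoints_continuous_eval _ _

theorem isIso_sobrificationMonad_unit_framePoints (A : Frm.{u}ᵒᵖ) :
    IsIso (sobrificationMonad.{u}.η.app (framePoints.obj A)) :=
  (TopCat.isoOfHomeo (X := TopCat.of (FrameHom A.unop Prop))
    (Y := TopCat.of (FrameHom C(FrameHom A.unop Prop, Prop) Prop))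
    (sierpinskiEvalHomeomorph A.unop)).isIso_hom

section Equalizer

variable (A : Type u)

/-- The continuous map `𝕊 ^ A → 𝕊 ^ L A` that sends `p` to its extension to a frame
homomorphism. -/
def extendToFreeFrame : TopCat.of (A → Prop) ⟶ TopCat.of (FreeFrame A → Prop) :=
  TopCat.ofHom ⟨fun p U => FreeFrame.lift p U, continuous_pi continuous_lift_apply⟩

variable [Order.Frame A]

/-- The continuous map `𝕊 ^ A → 𝕊 ^ L A` given by precomposition with the interpretation
`L A → A`. -/
def compInterpretation : TopCat.of (A → Prop) ⟶ TopCat.of (FreeFrame A → Prop) :=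
  TopCat.ofHom ⟨fun p U => p (FreeFrame.lift id U), continuous_pi fun _ => continuous_apply _⟩

/-- The embedding of the space of points `Frm(A, 2)` into the product `𝕊 ^ A`. -/
def framePointsInclusion : TopCat.of (FrameHom A Prop) ⟶ TopCat.of (A → Prop) :=
  TopCat.ofHom ⟨fun p a => p a, continuous_pi fun a => framePoints_continuous_eval A a⟩

theorem framePointsInclusion_condition :
    framePointsInclusion A ≫ extendToFreeFrame A =
      framePointsInclusion A ≫ compInterpretation A := by
  ext p U
  exact iff_of_eq (DFunLike.congr_fun (FreeFrame.hom_lift p id) U).symm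

/-- The space of points `Frm(A, 2)` is the equalizer of the maps `𝕊 ^ A ⇉ 𝕊 ^ L A`. -/
def framePointsIsEqualizer :
    IsLimit (Fork.ofι (framePointsInclusion A) (framePointsInclusion_condition A)) :=
  Fork.IsLimit.mk' _ fun s =>
    ⟨TopCat.ofHom
      ⟨fun t => FreeFrame.homOfMapLift (s.ι t : A → Prop) fun U =>
          (congrFun (ConcreteCategory.congr_hom s.condition t) U).symm,
        framePoints_continuous_iff.2 fun a => (continuous_apply a).comp s.ι.hom.continuous⟩,
      rfl, fun {m} hm => by
        ext t
        exact FrameHom.ext fun a => congrFun (ConcreteCategory.congr_hom hm t) a⟩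

end Equalizer

/-! ### Continuous maps between powers of the Sierpinski space -/

theorem sierpinskiPower_faithful : sierpinskiPower.{u}.Faithful where
  map_injective {X Y} f g hfg := by
    apply Quiver.Hom.unop_inj
    ext y
    refine FreeFrame.eq_of_forall_lift_eq fun p => ?_
    exact congrArg (fun k => (k.hom.hom : (X.unop.of → Prop) → Y.unop.of → Prop) p y) hfg

theorem sierpinskiPower_full : sierpinskiPower.{u}.Full where
  map_surjective {X Y} g := by
    let k : C(X.unop.of → Prop, Y.unop.of → Prop) := g.hom.hom
    choose U hU using fun y => exists_forall_lift_eq ((ContinuousMap.eval y).comp k)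
    refine ⟨Quiver.Hom.op ⟨TypeCat.ofHom U⟩, ?_⟩
    ext p
    exact funext fun y => hU y p

theorem sierpinskiPower_essSurj : sierpinskiPower.{u}.EssSurj where
  mem_essImage := fun ⟨_, ⟨X⟩⟩ => ⟨Opposite.op (Kleisli.mk _ X), ⟨Iso.refl _⟩⟩

theorem sierpinskiPower_isEquivalence : sierpinskiPower.{u}.IsEquivalence where
  faithful := sierpinskiPower_faithful
  full := sierpinskiPower_full
  essSurj := sierpinskiPower_essSurj

/-- The inverse of restriction to generators, as a natural isomorphism. -/
def sierpinskiPowerIso :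
    sierpinskiPower.{u} ⋙ sierInclusion.{u} ≅ kleisliToFrm.{u}.op ⋙ framePoints.{u} :=
  NatIso.ofComponents (fun X => TopCat.isoOfHomeo (FreeFrame.pointsHomeomorph X.unop.of))
    fun {X Y} f => by
      ext (p : X.unop.of → Prop)
      exact (FreeFrame.hom_lift (FreeFrame.lift p) (kleisliFun f.unop)).symm

/-! ### Sobrification as a right Kan extension -/

instance isIso_sobrificationMonad_unit_sierInclusion (S : Sier.{u}) :
    IsIso (sobrificationMonad.{u}.η.app (sierInclusion.obj S)) := by
  obtain ⟨_, ⟨Y⟩⟩ := S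
  have := isIso_sobrificationMonad_unit_framePoints (.op (Frm.of (FreeFrame Y)))
  exact (NatTrans.isIso_app_iff_of_iso sobrificationMonad.η
    (sierpinskiPowerIso.app (.op (Kleisli.mk _ Y)))).2 this

/-- The space `𝕊 ^ Y`, as an object of `Sier`. -/
def sierpinskiPowerObj (Y : Type u) : Sier.{u} :=
  ⟨TopCat.of (Y → Prop), ⟨Y⟩⟩

theorem unitInvAction_sierpinskiPowerObj (Y : Type u) :
    (unitInvAction sierInclusion.{u} sobrificationMonad).app (sierpinskiPowerObj Y) =
      TopCat.ofHom ⟨fun φ y => φ (ContinuousMap.eval y),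
        continuous_pi fun _ => framePoints_continuous_eval _ _⟩ :=
  IsIso.inv_eq_of_hom_inv_id rfl

section Sobrification

variable (X : TopCat.{u})

/-- The evaluation map `X → 𝕊 ^ Top(X, 𝕊)`, as a continuous map from `X` to a power of `𝕊`. -/
noncomputable def evalArrow : StructuredArrow X sierInclusion.{u} :=
  .mk (Y := sierpinskiPowerObj C(X, Prop))
    (sobrificationAdjunction.unit.app X ≫ framePointsInclusion C(X, Prop))

theorem nonempty_evalArrow_hom (a : StructuredArrow X sierInclusion.{u}) :
    Nonempty (evalArrow X ⟶ a) := by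
  obtain ⟨⟨⟩, ⟨_, ⟨Y⟩⟩, f⟩ := a
  let f' : C(X, Y → Prop) := f.hom
  let g : C(C(X, Prop) → Prop, Y → Prop) :=
    ⟨fun q y => q ((ContinuousMap.eval y).comp f'), continuous_pi fun _ => continuous_apply _⟩
  exact ⟨StructuredArrow.homMk (ObjectProperty.homMk (TopCat.ofHom g)) rfl⟩

theorem coneAt_π_app_evalArrow :
    ((Functor.RightExtension.mk _
      (unitInvAction sierInclusion.{u} sobrificationMonad)).coneAt X).π.app (evalArrow X) =
        framePointsInclusion C(X, Prop) := by
  change sobrificationMonad.map (evalArrow X).hom ≫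
    (unitInvAction sierInclusion.{u} sobrificationMonad).app (sierpinskiPowerObj C(X, Prop)) = _
  rw [unitInvAction_sierpinskiPowerObj]
  rfl

/-- The sobrification monad is a pointwise right Kan extension of the inclusion of `Sier` along
itself. -/
noncomputable def sobrificationIsPointwiseRightKanExtension :
    (Functor.RightExtension.mk _
      (unitInvAction sierInclusion.{u} sobrificationMonad)).IsPointwiseRightKanExtension :=
  fun X =>
    let v : StructuredArrow X sierInclusion.{u} :=
      .mk (Y := sierpinskiPowerObj (FreeFrame C(X, Prop)))
        ((evalArrow X).hom ≫ extendToFreeFrame C(X, Prop))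
    let f : evalArrow X ⟶ v :=
      StructuredArrow.homMk (ObjectProperty.homMk (extendToFreeFrame C(X, Prop))) rfl
    let g : evalArrow X ⟶ v :=
      StructuredArrow.homMk (ObjectProperty.homMk (compInterpretation C(X, Prop)))
        (congrArg (sobrificationAdjunction.unit.app X ≫ ·) (framePointsInclusion_condition _).symm)
    isLimitOfEqualizerAtWeaklyInitial _ (nonempty_evalArrow_hom X) f g (coneAt_π_app_evalArrow X)
      (framePointsIsEqualizer C(X, Prop))

end Sobrification

theorem mainTheorem11 :
    sierpinskiPower.{u}.IsEquivalence ∧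
    (∃ α : sierpinskiPower.{u} ⋙ sierInclusion.{u} ≅ kleisliToFrm.{u}.op ⋙ framePoints.{u},
      ∀ (X : Type u) (h : FrameHom (FreeFrame X) Prop) (x : X),
        (α.inv.app (Opposite.op (Kleisli.mk freeFrameMonad X)) h : X → Prop) x =
          h (FreeFrame.gen x)) ∧
    (∃ _ : sierInclusion.{u}.HasPointwiseRightKanExtension sierInclusion.{u},
      Nonempty (sobrificationMonad.{u} ≅ codensityMonad sierInclusion.{u})) := by
  have h := sobrificationIsPointwiseRightKanExtension.{u}
  have : sobrificationMonad.{u}.toFunctor.IsRightKanExtension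
      (unitInvAction sierInclusion sobrificationMonad) := h.isRightKanExtension
  have := h.hasPointwiseRightKanExtension
  exact ⟨sierpinskiPower_isEquivalence, ⟨sierpinskiPowerIso, fun _ _ _ => rfl⟩, this,
    ⟨(isMonadAction_unitInvAction _ _).isoCodensityMonad⟩⟩
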